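/- Let $(\Omega,\mu)$ be a measure space with positive measure $\mu$, let $H$ be a separable complex Hilbert space, and let $\{H_\omega\}_{\omega\in\Omega}$ be a family of separable complex Hilbert spaces, each $H_\omega$ being isometrically embedded in one Hilbert space $K$ (for instance in the Hilbert direct sum $K=\bigoplus_{\omega}H_\omega$, or, when $H_\omega=H_0$ for all $\omega$, in $K=H_0$). Call $\varphi\in\prod_{\omega}H_\omega$ strongly measurable if it is strongly measurable as a map $\Omega\to K$, and let $(\oplus_{\omega}H_\omega,\mu)_{L^2}$ be the space of strongly measurable $\varphi$ with $\int_\Omega\|\varphi(\omega)\|^2d\mu(\omega)<\infty$, whose elements are considered up to equality almost everywhere. Let $\Lambda=\{\Lambda_\omega\in B(H,H_\omega)\}_{\omega\in\Omega}$ be a family of bounded operators such that $\{\Lambda_\omega h\}_{\omega\in\Omega}$ is strongly measurable for each $h\in H$. It is called a $cg$-frame for $H$ with respect to $\{H_\omega\}$ if there are constants $A,B>0$ with $$A\|h\|^2\le\int_\Omega\|\Lambda_\omega h\|^2d\mu(\omega)\le B\|h\|^2,\qquad h\in H.$$ It is called a $cg$-orthonormal basis for $H$ with respect to $\{H_\omega\}$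 if $\int_\Omega\|\Lambda_\omega h\|^2d\mu(\omega)=\|h\|^2$ for all $h\in H$ and, for every $\{f_\omega\}\in(\oplus_{\omega}H_\omega,\mu)_{L^2}$, for almost all $\nu\in\Omega$, $$\int_\Omega\langle\Lambda_\omega^*f_\omega,\Lambda_\nu^*g_\nu\rangle\,d\mu(\omega)=\langle f_\nu,g_\nu\rangle\qquad\text{for all } g_\nu\in H_\nu.$$ Proposition. Suppose that $\{\Theta_\omega\}_{\omega\in\Omega}$ is a $cg$-orthonormal basis for $H$ with respect to $\{H_\omega\}_{\omega\in\Omega}$ and $\{\Lambda_\omega\}_{\omega\in\Omega}$ is a $cg$-frame for $H$ with respect to $\{H_\omega\}_{\omega\in\Omega}$. Then there exist $cg$-orthonormal bases $\{\Psi_\omega\}_{\omega\in\Omega}$, $\{\Gamma_\omega\}_{\omega\in\Omega}$ and $\{\Phi_\omega\}_{\omega\in\Omega}$ for $H$ with respect to $\{H_\omega\}_{\omega\in\Omega}$ and a constant $\alpha\in\mathbb{C}$ such that $$\Lambda_\omega=\alpha(\Psi_\omega+\Gamma_\omega+\Phi_\omega)\qquad\text{for almost all }\omega\in\Omega.$$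 -/

import Mathlib

open MeasureTheory

/-!
Setting: `Ω` is a measure space, `H` and `E ω` (`ω : Ω`) are complex Hilbert spaces. The fibres
`E ω` sit inside one Hilbert space `K` through linear isometries `ι ω : E ω → K`; this is what gives
a meaning to the measurability of a section `ω ↦ φ ω ∈ E ω`. Two cases are: the Hilbert direct sum
`K = ⊕ E ω` with its canonical embeddings, and a constant fibre `E ω = K` with `ι ω = id`
(where sections are just functions `Ω → K`).
-/

namespace CgFrame

variable {Ω : Type*} [MeasurableSpace Ω]
variable {H : Type*} [NormedAddCommGroup H] [InnerProductSpace ℂ H] [CompleteSpace H]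
variable {E : Ω → Type*} [∀ ω, NormedAddCommGroup (E ω)] [∀ ω, InnerProductSpace ℂ (E ω)]
  [∀ ω, CompleteSpace (E ω)]
variable {K : Type*} [NormedAddCommGroup K] [InnerProductSpace ℂ K]

/-- A section `φ ∈ ∏ E ω` is strongly measurable if it is so as a map into the ambient space. -/
def StronglyMeasurableSection (ι : ∀ ω, E ω →ₗᵢ[ℂ] K) (φ : ∀ ω, E ω) : Prop :=
  StronglyMeasurable fun ω => ι ω (φ ω)

/-- The section `φ` is (a representative of) an element of `(⊕ E ω, μ)_{L²}`: it is strongly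
measurable and `∫ ‖φ ω‖² dμ < ∞`. -/
structure IsL2Section (ι : ∀ ω, E ω →ₗᵢ[ℂ] K) (μ : Measure Ω) (φ : ∀ ω, E ω) : Prop where
  stronglyMeasurable : StronglyMeasurableSection ι φ
  lintegral_lt_top : ∫⁻ ω, ‖φ ω‖ₑ ^ 2 ∂μ < ⊤

/-- `Λ` is a continuous generalized frame (`cg`-frame) for `H` with respect to `(E ω)`. -/
structure IsCgFrame (ι : ∀ ω, E ω →ₗᵢ[ℂ] K) (μ : Measure Ω) (Λ : ∀ ω, H →L[ℂ] E ω) : Prop where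
  stronglyMeasurable : ∀ h : H, StronglyMeasurableSection ι fun ω => Λ ω h
  bounds : ∃ A B : ℝ, 0 < A ∧ 0 < B ∧ ∀ h : H,
    ENNReal.ofReal (A * ‖h‖ ^ 2) ≤ ∫⁻ ω, ‖Λ ω h‖ₑ ^ 2 ∂μ ∧
      ∫⁻ ω, ‖Λ ω h‖ₑ ^ 2 ∂μ ≤ ENNReal.ofReal (B * ‖h‖ ^ 2)

/-- `Θ` is a continuous generalized orthonormal basis (`cg`-orthonormal basis) for `H` with respect
to `(E ω)`. Mathlib's inner product `inner ℂ x y` is linear in `y`, so it is `⟨y, x⟩` in the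
convention where the first slot is the linear one. Elements of `L²` are determined up to null sets,
so the null set in `orthonormal` goes with the section `f`. The integrand there is integrable by the
other two conditions. -/
structure IsCgOrthonormalBasis (ι : ∀ ω, E ω →ₗᵢ[ℂ] K) (μ : Measure Ω)
    (Θ : ∀ ω, H →L[ℂ] E ω) : Prop where
  stronglyMeasurable : ∀ h : H, StronglyMeasurableSection ι fun ω => Θ ω h
  orthonormal : ∀ f : ∀ ω, E ω, IsL2Section ι μ f → ∀ᵐ ν ∂μ, ∀ g : E ν,
    ∫ ω, inner ℂ ((Θ ν).adjoint g) ((Θ ω).adjoint (f ω)) ∂μ = inner ℂ g (f ν)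
  parseval : ∀ h : H, ∫⁻ ω, ‖Θ ω h‖ₑ ^ 2 ∂μ = ENNReal.ofReal (‖h‖ ^ 2)

end CgFrame

open MeasureTheory

/-!
The analysis operator of a family `Λ` sends `h` to the section `ω ↦ Λ ω h` of `L²`. For a
`cg`-orthonormal basis `Θ` it is an isometry `T`, and `orthonormal` says exactly that `T T* = 1` on
`L²` sections: `Θ ν (T* f) = f ν` for almost all `ν`. If `S` is the analysis operator of the frame
`Λ` and `U = T* S`, then `Λ ω h = Θ ω (U h)` almost everywhere for each `h`, and separability of `H`
makes the null set independent of `h`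
(`CgFrame.IsCgOrthonormalBasis.exists_comp_ae_eq`).

It remains to write `U` as a multiple of a sum of three unitaries, since `Θ V` is again a
`cg`-orthonormal basis for unitary `V` (`CgFrame.IsCgOrthonormalBasis.comp_unitary`). After scaling,
`U` becomes `s` with `‖s‖ < 1`. Then `a = (1 + s) / 2` is within distance less than `1` of `1`,
hence invertible, and is a contraction; its polar decomposition is `a = u p` with `u` unitary and
`0 ≤ p ≤ 1`. As `w = p + i √(1 - p²)` is unitary with `w + w* = 2 p`, we get
`s = 2 a - 1 = u w + u w* - 1` (`CStarAlgebra.exists_unitary_add_unitary_sub_one`).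
-/

section CStarAlgebra

variable {A : Type*} [CStarAlgebra A]

/-- Polar decomposition of an invertible element of a C⋆-algebra. -/
lemma exists_unitary_mul_cfcAbs [PartialOrder A] [StarOrderedRing A] {a : A} (ha : IsUnit a) :
    ∃ u ∈ unitary A, u * CFC.abs a = a := by
  have hp : IsUnit (CFC.abs a) := by
    have h : IsUnit (CFC.abs a * CFC.abs a) := by
      rw [CFC.abs_mul_abs]; exact ha.star.mul ha
    exact ((Commute.refl (CFC.abs a)).isUnit_mul_iff.1 h).1
  obtain ⟨p, hp⟩ := hp
  have hsp : star (p : A) = p := by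
    rw [hp]; exact (CFC.abs_nonneg a).isSelfAdjoint
  have hu : IsUnit (a * ↑p⁻¹) := ha.mul p⁻¹.isUnit
  have h1 : star (a * ↑p⁻¹) * (a * ↑p⁻¹) = 1 := by
    have hsp' : star (↑p⁻¹ : A) = ↑p⁻¹ := by
      have : star p = p := Units.ext hsp
      rw [← Units.coe_star_inv, this]
    rw [star_mul, hsp', mul_assoc, ← mul_assoc (star a), ← CFC.abs_mul_abs, ← hp]
    simp
  refine ⟨a * ↑p⁻¹, Unitary.mem_iff.2 ⟨h1, ?_⟩, by rw [← hp]; simp [mul_assoc]⟩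
  obtain ⟨w, hw⟩ := hu
  rw [← hw] at h1 ⊢
  rw [← Units.inv_eq_of_mul_eq_one_left h1, Units.mul_inv]

/-- An element `s` of the open unit ball of a C⋆-algebra is a sum of three unitaries, one of which
can be taken to be `-1`. -/
theorem CStarAlgebra.exists_unitary_add_unitary_sub_one {s : A} (hs : ‖s‖ < 1) :
    ∃ v ∈ unitary A, ∃ w ∈ unitary A, s = v + w + -1 := by
  let _ := CStarAlgebra.spectralOrder A
  let _ := CStarAlgebra.spectralOrderedRing A
  obtain (_ | _) := subsingleton_or_nontrivial A
  · exact ⟨1, one_mem _, 1, one_mem _, Subsingleton.elim _ _⟩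
  have half (t : A) (ht : ‖t‖ < 1) : ‖(2⁻¹ : ℝ) • (1 + t)‖ < 1 := by
    have := norm_add_le 1 t
    rw [norm_smul, Real.norm_of_nonneg (by norm_num)]
    rw [norm_one] at this
    linarith
  set a : A := (2⁻¹ : ℝ) • (1 + s) with ha
  have ha_unit : IsUnit a := by
    have h : a = 1 - (2⁻¹ : ℝ) • (1 + -s) := by rw [ha]; module
    rw [h]
    exact isUnit_one_sub_of_norm_lt_one (half (-s) (by rwa [norm_neg]))
  obtain ⟨u, hu, hua⟩ := exists_unitary_mul_cfcAbs ha_unit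
  let p : selfAdjoint A := ⟨CFC.abs a, (CFC.abs_nonneg a).isSelfAdjoint⟩
  have hp : ‖p‖ ≤ 1 := by
    change ‖CFC.abs a‖ ≤ 1
    rw [CFC.norm_abs]
    exact (half s hs).le
  let w := selfAdjoint.unitarySelfAddISMul p hp
  refine ⟨u * w, mul_mem hu w.2, u * (star w : unitary A), mul_mem hu (star w).2, ?_⟩
  have hw : (w : A) + (star w : unitary A) = (2 : ℝ) • CFC.abs a := by
    dsimp only [w]
    rw [Unitary.coe_star, selfAdjoint.star_coe_unitarySelfAddISMul,
      selfAdjoint.unitarySelfAddISMul_coe]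
    module
  rw [← mul_add, hw, mul_smul_comm, hua, ha]
  module

end CStarAlgebra

namespace CgFrame

variable {Ω : Type*} [MeasurableSpace Ω] {μ : Measure Ω}
variable {H : Type*} [NormedAddCommGroup H] [InnerProductSpace ℂ H]
variable {E : Ω → Type*} [∀ ω, NormedAddCommGroup (E ω)] [∀ ω, InnerProductSpace ℂ (E ω)]
variable {K : Type*} [NormedAddCommGroup K] [InnerProductSpace ℂ K]
variable {ι : ∀ ω, E ω →ₗᵢ[ℂ] K}

lemma IsL2Section.memLp {f : ∀ ω, E ω} (hf : IsL2Section ι μ f) :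
    MemLp (fun ω => ι ω (f ω)) 2 μ := by
  refine ⟨hf.stronglyMeasurable.aestronglyMeasurable, ?_⟩
  rw [eLpNorm_lt_top_iff_lintegral_rpow_enorm_lt_top (by norm_num) (by norm_num)]
  simpa [LinearIsometry.enorm_map] using hf.lintegral_lt_top

lemma IsL2Section.enorm_toLp_sq {f : ∀ ω, E ω} (hf : IsL2Section ι μ f) :
    ‖hf.memLp.toLp‖ₑ ^ 2 = ∫⁻ ω, ‖f ω‖ₑ ^ 2 ∂μ := by
  rw [Lp.enorm_toLp, eLpNorm_eq_lintegral_rpow_enorm_toReal (by norm_num) (by norm_num),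
    ← ENNReal.rpow_natCast, ← ENNReal.rpow_mul]
  simp

/-- A Bessel family `Λ`, that is, one satisfying the measurability and upper bound of a `cg`-frame,
has a bounded analysis operator `h ↦ (Λ ω h)_ω`. Its values are taken in `L²(Ω, μ; K)`, the sections
being embedded through `ι`. -/
lemma exists_analysisOperator {Λ : ∀ ω, H →L[ℂ] E ω} {B : ℝ}
    (hm : ∀ h, StronglyMeasurableSection ι fun ω => Λ ω h)
    (hB : ∀ h, ∫⁻ ω, ‖Λ ω h‖ₑ ^ 2 ∂μ ≤ ENNReal.ofReal (B * ‖h‖ ^ 2)) :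
    ∃ T : H →L[ℂ] Lp K 2 μ, ∀ h, T h =ᵐ[μ] fun ω => ι ω (Λ ω h) := by
  have hL (h : H) : IsL2Section ι μ fun ω => Λ ω h :=
    ⟨hm h, (hB h).trans_lt ENNReal.ofReal_lt_top⟩
  let T₀ : H →ₗ[ℂ] Lp K 2 μ :=
    { toFun := fun h => (hL h).memLp.toLp
      map_add' := fun x y => by
        rw [← MemLp.toLp_add]
        exact MemLp.toLp_congr _ _ (.of_forall fun ω => by simp)
      map_smul' := fun c x => by
        rw [RingHom.id_apply, ← MemLp.toLp_const_smul]
        exact MemLp.toLp_congr _ _ (.of_forall fun ω => by simp) }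
  refine ⟨T₀.mkContinuous √B fun h => ?_, fun h => (hL h).memLp.coeFn_toLp⟩
  have h1 : ‖T₀ h‖ₑ ^ 2 ≤ ENNReal.ofReal (B * ‖h‖ ^ 2) := (hL h).enorm_toLp_sq.trans_le (hB h)
  rw [← ofReal_norm, ← ENNReal.ofReal_pow (norm_nonneg _)] at h1
  rcases le_total 0 B with hB0 | hB0
  · rw [ENNReal.ofReal_le_ofReal_iff (by positivity)] at h1
    refine le_of_sq_le_sq ?_ (by positivity)
    rwa [mul_pow, Real.sq_sqrt hB0]
  · have : ENNReal.ofReal (B * ‖h‖ ^ 2) = 0 :=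
      ENNReal.ofReal_of_nonpos (mul_nonpos_of_nonpos_of_nonneg hB0 (by positivity))
    rw [this, nonpos_iff_eq_zero, ENNReal.ofReal_eq_zero] at h1
    have : ‖T₀ h‖ = 0 := by nlinarith [norm_nonneg (T₀ h)]
    rw [this]; positivity

variable [CompleteSpace H] [∀ ω, CompleteSpace (E ω)]

/-- A `cg`-frame `Λ` is the image of a `cg`-orthonormal basis `Θ` under an operator: `Λ = Θ U`
almost everywhere. -/
theorem IsCgOrthonormalBasis.exists_comp_ae_eq [TopologicalSpace.SeparableSpace H]
    [CompleteSpace K] {Θ Λ : ∀ ω, H →L[ℂ] E ω}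
    (hΘ : IsCgOrthonormalBasis ι μ Θ) (hΛ : IsCgFrame ι μ Λ) :
    ∃ U : H →L[ℂ] H, ∀ᵐ ω ∂μ, Λ ω = Θ ω ∘L U := by
  obtain ⟨_, B, -, -, hB⟩ := hΛ.bounds
  obtain ⟨T, hT⟩ := exists_analysisOperator hΘ.stronglyMeasurable (B := 1)
    fun h => by rw [one_mul]; exact (hΘ.parseval h).le
  obtain ⟨S, hS⟩ := exists_analysisOperator hΛ.stronglyMeasurable fun h => (hB h).2
  refine ⟨T.adjoint ∘L S, ?_⟩
  -- For a fixed `y` the null set comes from `orthonormal` for the section `Λ y`.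
  have key (y : H) : ∀ᵐ ν ∂μ, Λ ν y = Θ ν (T.adjoint (S y)) := by
    have hL : IsL2Section ι μ fun ω => Λ ω y :=
      ⟨hΛ.stronglyMeasurable y, (hB y).2.trans_lt ENNReal.ofReal_lt_top⟩
    filter_upwards [hΘ.orthonormal _ hL] with ν hν
    refine ext_inner_left ℂ fun g => ?_
    rw [← hν g, ← ContinuousLinearMap.adjoint_inner_left, ContinuousLinearMap.adjoint_inner_right,
      L2.inner_def]
    refine integral_congr_ae ?_
    filter_upwards [hT ((Θ ν).adjoint g), hS y] with ω h1 h2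
    rw [h1, h2, LinearIsometry.inner_map_map, ContinuousLinearMap.adjoint_inner_right]
  filter_upwards [ae_all_iff.2 fun n => key (TopologicalSpace.denseSeq H n)] with ω hω
  exact DFunLike.coe_injective <| (TopologicalSpace.denseRange_denseSeq H).equalizer
    (Λ ω).continuous (Θ ω ∘L T.adjoint ∘L S).continuous (funext hω)

lemma IsCgOrthonormalBasis.comp_unitary {Θ : ∀ ω, H →L[ℂ] E ω}
    (hΘ : IsCgOrthonormalBasis ι μ Θ) {V : H →L[ℂ] H} (hV : V ∈ unitary (H →L[ℂ] H)) :
    IsCgOrthonormalBasis ι μ fun ω => Θ ω ∘L V where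
  stronglyMeasurable h := hΘ.stronglyMeasurable (V h)
  orthonormal f hf := by
    filter_upwards [hΘ.orthonormal f hf] with ν hν g
    have hV' : V.adjoint ∈ unitary (H →L[ℂ] H) := Unitary.star_mem hV
    simpa [ContinuousLinearMap.adjoint_comp,
      ContinuousLinearMap.inner_map_map_of_mem_unitary hV'] using hν g
  parseval h := by
    simpa [ContinuousLinearMap.norm_map_of_mem_unitary hV] using hΘ.parseval (V h)

end CgFrame


theorem proposition09
    {Ω : Type*} [MeasurableSpace Ω] (μ : Measure Ω)
    {H : Type*} [NormedAddCommGroup H] [InnerProductSpace ℂ H] [CompleteSpace H]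
    [TopologicalSpace.SeparableSpace H]
    {E : Ω → Type*} [∀ ω, NormedAddCommGroup (E ω)] [∀ ω, InnerProductSpace ℂ (E ω)]
    [∀ ω, CompleteSpace (E ω)] [∀ ω, TopologicalSpace.SeparableSpace (E ω)]
    {K : Type*} [NormedAddCommGroup K] [InnerProductSpace ℂ K] [CompleteSpace K]
    (ι : ∀ ω, E ω →ₗᵢ[ℂ] K)
    (Θ Λ : ∀ ω, H →L[ℂ] E ω)
    (hΘ : CgFrame.IsCgOrthonormalBasis ι μ Θ) (hΛ : CgFrame.IsCgFrame ι μ Λ) :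
    ∃ (Ψ Γ Φ : ∀ ω, H →L[ℂ] E ω) (α : ℂ),
      CgFrame.IsCgOrthonormalBasis ι μ Ψ ∧ CgFrame.IsCgOrthonormalBasis ι μ Γ ∧
        CgFrame.IsCgOrthonormalBasis ι μ Φ ∧
        ∀ᵐ ω ∂μ, Λ ω = α • (Ψ ω + Γ ω + Φ ω) := by

  obtain ⟨U, hU⟩ := hΘ.exists_comp_ae_eq hΛ
  -- Any positive constant above `‖U‖` brings `U` into the open unit ball.
  set c : ℝ := ‖U‖ + 1
  have hc : 0 < c := by positivity
  have hs : ‖(c⁻¹ : ℂ) • U‖ < 1 := by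
    rw [norm_smul, norm_inv, Complex.norm_of_nonneg hc.le, inv_mul_lt_one₀ hc]
    exact lt_add_one _
  obtain ⟨V, hV, W, hW, hVW⟩ := CStarAlgebra.exists_unitary_add_unitary_sub_one hs
  have hc' : (c : ℂ) ≠ 0 := Complex.ofReal_ne_zero.2 hc.ne'
  refine ⟨_, _, _, c, hΘ.comp_unitary hV, hΘ.comp_unitary hW,
    hΘ.comp_unitary (V := -1) (-(1 : unitary (H →L[ℂ] H))).2, ?_⟩
  filter_upwards [hU] with ω hω
  rw [hω, ← ContinuousLinearMap.comp_add, ← ContinuousLinearMap.comp_add, ← hVW,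
    ContinuousLinearMap.comp_smul, smul_inv_smul₀ hc']
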